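/- Let $n\ge 0$ be an integer and $c=2^{-n/2}\pi^{-3n/4}$. For $h>0$ and $u\in L^2(\mathbb R^n)$ let $$Tu(z,\zeta)=c\,h^{-3n/4}\int_{\mathbb R^n}e^{\frac ih\Phi(z,\zeta,y)}u(y)\,dy,\qquad \Phi(z,\zeta,y)=\langle z-y,\zeta\rangle+\tfrac i2(z-y)^2,\qquad (z,\zeta)\in\mathbb C^n\times\mathbb C^n,$$ be the holomorphic extension of the FBI transform $Tu(x,\xi)$, $(x,\xi)\in T^*\mathbb R^n=\mathbb R^{2n}$; here $\langle\cdot,\cdot\rangle$ is bilinear and $w^2=\langle w,w\rangle$. For real-valued $G\in C_c^\infty(\mathbb R^{2n})$ put $$\Lambda=\Lambda_G=\{(x+iG_\xi(x,\xi),\,\xi-iG_x(x,\xi)):(x,\xi)\in\mathbb R^{2n}\},\qquad T_\Lambda u(x,\xi)=Tu(x+iG_\xi(x,\xi),\,\xi-iG_x(x,\xi)),$$ $$H(x,\xi)=G(x,\xi)-\xi\cdot G_\xi(x,\xi)\qquad(\text{so that } dH=-\operatorname{Im}\zeta\cdot dz|_\Lambda),$$ $$\varphi_0(x,\xi,y)=\Phi(x,\xi,y),\qquad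 \widetilde\varphi_G(x',\xi',y)=\langle y-z,\zeta\rangle+\tfrac i2(z-y)^2\ \text{ with } z=x'+iG_{\xi}(x',\xi'),\ \zeta=\xi'-iG_{x}(x',\xi').$$ Theorem. There exist $\epsilon_0>0$ and $C_0>0$, depending only on $n$, such that for every real-valued $G\in C_c^\infty(\mathbb R^{2n})$ with $\|G\|_{C^2}<\epsilon_0$ there is a function $\varphi\in C_c^\infty(\mathbb R^{2n};\mathbb R)$ given by $$\varphi(x,\xi)=\max_{(x',\xi')\in\mathbb R^{2n}}\Big(-\operatorname{Im}\,\mathrm{c.v.}_{y}\big(\varphi_0(x,\xi,y)+\widetilde\varphi_G(x',\xi',y)\big)+H(x',\xi')\Big)$$ (where $\mathrm{c.v.}_y$ is the critical value of a function of $y\in\mathbb C^n$, and the maximum is attained), such that for all $h>0$ and all $v\in L^2(\mathbb R^n)$ we have $T_\Lambda v\in L^2_\Lambda$, $Tv\in L^2_\varphi$ and $$\|T_\Lambda v\|_{L^2_\Lambda}/C_0\ \le\ \|Tv\|_{L^2_\varphi}\ \le\ C_0\,\|T_\Lambda v\|_{L^2_\Lambda},$$ where $L^2_\Lambda=L^2(\mathbb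 R^{2n},e^{-2H(x,\xi)/h}\,dx\,d\xi)$ (with $\Lambda$ parametrized by $(x,\xi)$) and $L^2_\varphi=L^2(\mathbb R^{2n},e^{-2\varphi(x,\xi)/h}\,dx\,d\xi)$. In other words, deforming phase space is equivalent to using a weight, uniformly in $h$. -/

import Mathlib

open MeasureTheory
open scoped ContDiff ENNReal NNReal

noncomputable section

namespace FBIWeights

/-- The configuration space `ℝⁿ` with its Euclidean structure. -/
abbrev Rn (n : ℕ) : Type := EuclideanSpace ℝ (Fin n)

/-- The phase space `T*ℝⁿ = ℝⁿ × ℝⁿ`, with points `(x, ξ)`. -/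
abbrev PhaseSpace (n : ℕ) : Type := Rn n × Rn n

/-- The inclusion `ℝⁿ ⊂ ℂⁿ`. -/
def toC {n : ℕ} (x : Rn n) : Fin n → ℂ := fun j => (x j : ℂ)

/-- The holomorphic phase `Φ(z, ζ, y) = ⟨z - y, ζ⟩ + (i/2) (z - y)²` of the FBI transform, where
`⟨·, ·⟩` is bilinear and `w² = ∑ wⱼ²`. -/
def phase {n : ℕ} (z ζ y : Fin n → ℂ) : ℂ :=
  ∑ j, (z j - y j) * ζ j + Complex.I / 2 * ∑ j, (z j - y j) ^ 2

/-- The phase `⟨y - z, ζ⟩ + (i/2) (z - y)²` of the adjoint transform. It is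
`-conj (Φ(conj z, conj ζ, conj y))`. -/
def adjPhase {n : ℕ} (z ζ y : Fin n → ℂ) : ℂ :=
  ∑ j, (y j - z j) * ζ j + Complex.I / 2 * ∑ j, (z j - y j) ^ 2

/-- The constant `c = 2^{-n/2} π^{-3n/4}`, which makes the FBI transform an isometry
`L²(ℝⁿ) → L²(T*ℝⁿ)`. -/
def fbiConst (n : ℕ) : ℝ := (2 : ℝ) ^ (-((n : ℝ) / 2)) * Real.pi ^ (-(3 * (n : ℝ) / 4))

/-- The holomorphic extension to `T*ℂⁿ = ℂⁿ × ℂⁿ` of the FBI transform: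
`(T u)(z, ζ) = c h^{-3n/4} ∫ exp((i/h) Φ(z, ζ, y)) u(y) dy`. -/
def fbi {n : ℕ} (h : ℝ) (u : Rn n → ℂ) (z ζ : Fin n → ℂ) : ℂ :=
  ((fbiConst n * h ^ (-(3 * (n : ℝ) / 4)) : ℝ) : ℂ) *
    ∫ y : Rn n, Complex.exp (Complex.I / (h : ℂ) * phase z ζ (toC y)) * u y

/-- The FBI transform `T u` on `T*ℝⁿ`. -/
def fbiReal {n : ℕ} (h : ℝ) (u : Rn n → ℂ) (p : PhaseSpace n) : ℂ :=
  fbi h u (toC p.1) (toC p.2)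

/-- The partial derivative `∂G/∂xⱼ`. -/
def dX {n : ℕ} (G : PhaseSpace n → ℝ) (p : PhaseSpace n) (j : Fin n) : ℝ :=
  fderiv ℝ G p (EuclideanSpace.single j 1, 0)

/-- The partial derivative `∂G/∂ξⱼ`. -/
def dXi {n : ℕ} (G : PhaseSpace n → ℝ) (p : PhaseSpace n) (j : Fin n) : ℝ :=
  fderiv ℝ G p (0, EuclideanSpace.single j 1)

/-- The component `z = x + i G_ξ(x, ξ)` of the parametrization of `Λ_G`. -/
def lamZ {n : ℕ} (G : PhaseSpace n → ℝ) (p : PhaseSpace n) : Fin n → ℂ :=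
  fun j => (p.1 j : ℂ) + Complex.I * (dXi G p j : ℂ)

/-- The component `ζ = ξ - i G_x(x, ξ)` of the parametrization of `Λ_G`. -/
def lamZeta {n : ℕ} (G : PhaseSpace n → ℝ) (p : PhaseSpace n) : Fin n → ℂ :=
  fun j => (p.2 j : ℂ) - Complex.I * (dX G p j : ℂ)

/-- The deformed FBI transform `T_Λ u (x, ξ) = T u (x + i G_ξ, ξ - i G_x)`: the restriction of the
holomorphic extension of `T u` to `Λ_G`, which is parametrized by `(x, ξ) ∈ T*ℝⁿ`. -/
def fbiLam {n : ℕ} (G : PhaseSpace n → ℝ) (h : ℝ) (u : Rn n → ℂ) (p : PhaseSpace n) : ℂ :=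
  fbi h u (lamZ G p) (lamZeta G p)

/-- The weight `H = G - ξ · G_ξ` of the deformation. -/
def weightH {n : ℕ} (G : PhaseSpace n → ℝ) (p : PhaseSpace n) : ℝ :=
  G p - ∑ j, p.2 j * dXi G p j

/-- The number `s` is a critical value of `f : ℂⁿ → ℂ`. -/
def IsCriticalValue {n : ℕ} (f : (Fin n → ℂ) → ℂ) (s : ℂ) : Prop :=
  ∃ y : Fin n → ℂ, HasFDerivAt f (0 : (Fin n → ℂ) →L[ℂ] ℂ) y ∧ f y = s

/-- The set of all values
`- Im c.v._y (Φ(x, ξ, y) + φ̃_G(x', ξ', y)) + H(x', ξ')`, `(x', ξ') ∈ ℝ²ⁿ`, where `p = (x, ξ)` and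
`φ̃_G` is the phase of the adjoint transform on `Λ_G`. -/
def weightValues {n : ℕ} (G : PhaseSpace n → ℝ) (p : PhaseSpace n) : Set ℝ :=
  {r | ∃ (q : PhaseSpace n) (s : ℂ),
    IsCriticalValue (fun y => phase (toC p.1) (toC p.2) y + adjPhase (lamZ G q) (lamZeta G q) y) s ∧
      r = -s.im + weightH G q}

/-- The `C²` norm `∑_{k ≤ 2} sup ‖DᵏG‖`. -/
def C2norm {n : ℕ} (G : PhaseSpace n → ℝ) : ℝ :=
  ∑ k ∈ Finset.range 3, ⨆ p, ‖iteratedFDeriv ℝ k G p‖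

/-- The measure `exp(-2 w(x, ξ) / h) dx dξ` on `ℝ²ⁿ`. -/
def expMeasure {n : ℕ} (h : ℝ) (w : PhaseSpace n → ℝ) : Measure (PhaseSpace n) :=
  volume.withDensity fun p => ENNReal.ofReal (Real.exp (-(2 * w p) / h))

/-- The weight `H` satisfies `dH = - Im (ζ · dz)|_Λ`. -/
theorem fderiv_weightH {n : ℕ} (G : PhaseSpace n → ℝ) (hG : ContDiff ℝ ∞ G)
    (p w : PhaseSpace n) :
    fderiv ℝ (weightH G) p w =
      -(∑ j, lamZeta G p j * fderiv ℝ (fun q => lamZ G q j) p w).im := by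
  have hd : ∀ j, DifferentiableAt ℝ (fun q => dXi G q j) p := by
    intro j
    have h1 : ContDiff ℝ 1 (fderiv ℝ G) := hG.fderiv_right (by norm_cast)
    exact ((h1.differentiable one_ne_zero).clm_apply (differentiable_const _)) p
  have hGd : DifferentiableAt ℝ G p := hG.contDiffAt.differentiableAt (by simp)
  let P2 : Fin n → (PhaseSpace n →L[ℝ] ℝ) := fun j =>
    (EuclideanSpace.proj j : Rn n →L[ℝ] ℝ).comp (ContinuousLinearMap.snd ℝ (Rn n) (Rn n))
  let P1 : Fin n → (PhaseSpace n →L[ℝ] ℝ) := fun j =>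
    (EuclideanSpace.proj j : Rn n →L[ℝ] ℝ).comp (ContinuousLinearMap.fst ℝ (Rn n) (Rn n))
  have hH : HasFDerivAt (weightH G)
      (fderiv ℝ G p - ∑ j, (p.2 j • fderiv ℝ (fun q => dXi G q j) p + dXi G p j • P2 j)) p := by
    refine hGd.hasFDerivAt.sub (HasFDerivAt.fun_sum fun j _ => ?_)
    exact (P2 j).hasFDerivAt.mul (hd j).hasFDerivAt
  have hZ : ∀ j, HasFDerivAt (fun q => lamZ G q j)
      (Complex.ofRealCLM.comp (P1 j) +
        Complex.I • Complex.ofRealCLM.comp (fderiv ℝ (fun q => dXi G q j) p)) p := by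
    intro j
    refine (Complex.ofRealCLM.hasFDerivAt.comp p (P1 j).hasFDerivAt).add ?_
    exact (Complex.ofRealCLM.hasFDerivAt.comp p (hd j).hasFDerivAt).const_mul Complex.I
  have hw : w = ∑ j, (w.1 j • ((EuclideanSpace.single j 1, 0) : PhaseSpace n) +
      w.2 j • ((0, EuclideanSpace.single j 1) : PhaseSpace n)) := by
    ext k
    · simp [Prod.fst_sum, Pi.single_apply]
    · simp [Prod.snd_sum, Pi.single_apply]
  have hGw : fderiv ℝ G p w = ∑ j, (w.1 j * dX G p j + w.2 j * dXi G p j) := by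
    conv_lhs => rw [hw]
    simp only [map_sum, map_add, map_smul, smul_eq_mul, dX, dXi]
  rw [hH.fderiv, Complex.im_sum, ← Finset.sum_neg_distrib]
  simp only [sub_apply, hGw, sum_apply,
    ← Finset.sum_sub_distrib]
  refine Finset.sum_congr rfl fun j _ => ?_
  rw [(hZ j).fderiv]
  simp [lamZeta, P1, P2]
  ring

end FBIWeights

end

/-! Completing the square gives `T u(z, ζ) = exp(-ζ²/(2h)) F(z - iζ)` with `F` entire, a constant
times a Gaussian transform of `u` (`fbi_eq_gaussTransform`). At the point of `Λ` with parameter `q`,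
`z - iζ` is also the value taken at the real point `κ(q) = q - ∇G(q)`. So `T_Λ u(q)` is an explicit
exponential times `T u(κ(q))`, and no asymptotics in `h` are needed.

The exponentials match exactly: `exp(-2H/h)|T_Λ u|²` at `q` equals `exp(-2φ/h)|T u|²` at `κ(q)` once
`φ(κ(q)) = G(q) - |∇G(q)|²/2` (`enorm_fbiLam_sq_mul`). If `∇G` is 1/4-Lipschitz, `κ` is a
diffeomorphism with Jacobian bounded above and below in terms of `n` alone, so the change of
variables compares the two norms uniformly in `h`.

That this `φ` is the prescribed maximum follows from computing the critical value explicitly and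
comparing two Taylor bounds for `G` (`isGreatest_weightValues`). Finiteness of the norms comes from
Plancherel in `ξ` and boundedness of `φ`. -/

open FourierTransform

namespace FBIWeights

noncomputable section

/-! ### Plancherel and measurability -/

/-- Plancherel's theorem for functions in `L¹ ∩ L²`. -/
theorem eLpNorm_fourier_eq {E : Type*} [NormedAddCommGroup E] [MeasurableSpace E] [BorelSpace E]
    [InnerProductSpace ℝ E] [FiniteDimensional ℝ E] {f : E → ℂ} (h1 : Integrable f volume)
    (h2 : MemLp f 2 volume) : eLpNorm (𝓕 f) 2 volume = eLpNorm f 2 volume := by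
  set F : Lp ℂ 2 (volume : Measure E) := 𝓕 (h2.toLp f)
  -- The `L²` transform and the integral agree as distributions: pair both with a test function and
  -- move the transform onto it.
  have key : ∀ᵐ x, F x = 𝓕 f x := by
    have hloc : LocallyIntegrable (F : E → ℂ) := (Lp.memLp F).locallyIntegrable (by norm_num)
    have hcont : Continuous (𝓕 f) :=
      VectorFourier.fourierIntegral_continuous Real.continuous_fourierChar
        (innerSL ℝ).continuous₂ h1
    refine ae_eq_of_integral_contDiff_smul_eq hloc hcont.locallyIntegrable fun g hg hgs => ?_
    have hg₁ : HasCompactSupport (Complex.ofRealCLM ∘ g) := hgs.comp_left rfl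
    have hg₂ : ContDiff ℝ ∞ (Complex.ofRealCLM ∘ g) := by fun_prop
    let ψ : SchwartzMap E ℂ := hg₁.toSchwartzMap hg₂
    have hψ : ∀ x, ψ x = (g x : ℂ) := fun x => by simp [ψ]
    have h3 := congrArg (fun T => T ψ) (Lp.fourier_toTemperedDistribution_eq (h2.toLp f))
    simp only [TemperedDistribution.fourier_apply, Lp.toTemperedDistribution_apply] at h3
    have h4 : ∫ x, (𝓕 ψ) x • (h2.toLp f) x = ∫ x, (𝓕 ψ) x • f x := by
      refine integral_congr_ae ?_
      filter_upwards [h2.coeFn_toLp] with x hx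
      rw [hx]
    rw [h4] at h3
    have h5 : ∫ x, (𝓕 ψ) x • f x = ∫ x, ψ x • (𝓕 f) x := by
      have := VectorFourier.integral_fourierIntegral_smul_eq_flip (μ := (volume : Measure E))
        (ν := (volume : Measure E)) (L := innerₗ E) (f := (ψ : E → ℂ)) (g := f)
        Real.continuous_fourierChar (innerSL ℝ).continuous₂ ψ.integrable h1
      rw [flip_innerₗ] at this
      exact this
    rw [h5] at h3
    simp only [hψ, smul_eq_mul] at h3
    simp only [Complex.real_smul]
    exact h3.symm
  rw [← eLpNorm_congr_ae key]
  have := Lp.norm_fourier_eq (h2.toLp f)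
  rw [Lp.norm_def, Lp.norm_def, ENNReal.toReal_eq_toReal_iff' (Lp.eLpNorm_ne_top _)
    (Lp.eLpNorm_ne_top _)] at this
  rw [this, eLpNorm_congr_ae h2.coeFn_toLp]

theorem stronglyMeasurable_fbi {n : ℕ} (h : ℝ) {v : Rn n → ℂ}
    (hv : AEStronglyMeasurable v volume) {z ζ : PhaseSpace n → Fin n → ℂ} (hz : Continuous z)
    (hζ : Continuous ζ) :
    StronglyMeasurable (fun p => fbi h v (z p) (ζ p)) := by
  -- Changing `v` on a null set alters no value of the integral, so a measurable representative
  -- gives measurability everywhere.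
  have h1 : (fun p => fbi h v (z p) (ζ p)) = fun p => fbi h (hv.mk v) (z p) (ζ p) := by
    funext p
    unfold fbi
    congr 1
    refine integral_congr_ae ?_
    filter_upwards [hv.ae_eq_mk] with y hy
    rw [← hy]
  rw [h1]
  refine stronglyMeasurable_const.mul ?_
  refine StronglyMeasurable.integral_prod_right' (f := fun q : PhaseSpace n × Rn n =>
    Complex.exp (Complex.I / (h : ℂ) * phase (z q.1) (ζ q.1) (toC q.2)) * hv.mk v q.2) ?_
  refine StronglyMeasurable.mul (Continuous.stronglyMeasurable ?_)
    (hv.stronglyMeasurable_mk.comp_measurable measurable_snd)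
  unfold phase toC
  fun_prop

/-! ### Gaussian and windowed Fourier forms of the transform; `L²` bound -/

/-- The Gaussian integral `∫ exp(-(w - y)²/(2h)) u(y) dy`, an entire function of `w ∈ ℂⁿ`. -/
def gaussTransform {n : ℕ} (h : ℝ) (u : Rn n → ℂ) (w : Fin n → ℂ) : ℂ :=
  ∫ y : Rn n, Complex.exp (-(∑ j, (w j - toC y j) ^ 2) / (2 * h)) * u y

/-- Completing the square: `T u(z, ζ)` is `exp(-ζ²/(2h))` times a function of `z - iζ`. -/
theorem fbi_eq_gaussTransform {n : ℕ} {h : ℝ} (hh : h ≠ 0) (u : Rn n → ℂ) (z ζ : Fin n → ℂ) :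
    fbi h u z ζ = Complex.exp (-(∑ j, ζ j ^ 2) / (2 * h)) *
      (((fbiConst n * h ^ (-(3 * (n : ℝ) / 4)) : ℝ) : ℂ) *
        gaussTransform h u fun j => z j - Complex.I * ζ j) := by
  have hh' : (h : ℂ) ≠ 0 := by exact_mod_cast hh
  rw [fbi, gaussTransform, mul_left_comm, ← integral_const_mul (Complex.exp _)]
  congr 2
  funext y
  rw [← mul_assoc, ← Complex.exp_add]
  congr 2
  -- The identity is `iΦ/h = -(ζ² + (z - iζ - y)²)/(2h)`.
  unfold phase
  rw [mul_add, ← add_div, ← mul_assoc, Finset.mul_sum, Finset.mul_sum, ← Finset.sum_add_distrib,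
    ← neg_add, ← Finset.sum_add_distrib, ← Finset.sum_neg_distrib, Finset.sum_div]
  refine Finset.sum_congr rfl fun j _ => ?_
  field_simp
  linear_combination ((z j - toC y j) ^ 2 + ζ j ^ 2) * Complex.I_sq

/-- On `T*ℝⁿ` the FBI transform is, up to a phase, a windowed Fourier transform. -/
theorem enorm_fbiReal {n : ℕ} {h : ℝ} (hh : 0 < h) (v : Rn n → ℂ) (x ξ : Rn n) :
    ‖fbiReal h v (x, ξ)‖ₑ = ‖fbiConst n * h ^ (-(3 * (n : ℝ) / 4))‖ₑ *
      ‖𝓕 (fun y => Complex.exp ((-‖x - y‖ ^ 2 / (2 * h) : ℝ)) * v y)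
        ((2 * Real.pi * h)⁻¹ • ξ)‖ₑ := by
  have hh' : (h : ℂ) ≠ 0 := by exact_mod_cast hh.ne'
  have hpi : (Real.pi : ℂ) ≠ 0 := by exact_mod_cast Real.pi_ne_zero
  have hin : ∀ x ξ : Rn n, inner ℝ x ξ = ∑ j, x j * ξ j := fun x ξ => by
    simp [PiLp.inner_apply, mul_comm]
  -- The factor `exp(i⟨x, ξ⟩/h)` is unimodular; the frequency is `ξ/(2πh)` because `𝓕` has kernel
  -- `exp(-2πi⟨y, ·⟩)`.
  have key : ∀ y : Rn n, Complex.exp (Complex.I / (h : ℂ) * phase (toC x) (toC ξ) (toC y)) * v y =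
      Complex.exp ((inner ℝ x ξ / h : ℝ) * Complex.I) *
      (Complex.exp ((-2 * Real.pi * inner ℝ y ((2 * Real.pi * h)⁻¹ • ξ) : ℝ) * Complex.I) •
        (Complex.exp ((-‖x - y‖ ^ 2 / (2 * h) : ℝ)) * v y)) := by
    intro y
    rw [smul_eq_mul, ← mul_assoc, ← mul_assoc, ← Complex.exp_add, ← Complex.exp_add]
    congr 2
    rw [inner_smul_right, hin, hin, EuclideanSpace.norm_sq_eq]
    simp only [phase, toC, PiLp.sub_apply, Real.norm_eq_abs, sq_abs]
    push_cast
    simp only [sub_mul, Finset.sum_sub_distrib]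
    field_simp
    linear_combination (∑ j, ((x j : ℂ) - y j) ^ 2) * Complex.I_sq
  rw [fbiReal, fbi, Real.fourier_eq']
  simp only [key]
  rw [integral_const_mul, enorm_mul, enorm_mul, Complex.enorm_exp_ofReal_mul_I, one_mul]
  congr 1
  simp [enorm_eq_nnnorm]

theorem lintegral_comp_smul_eq {E : Type*} [NormedAddCommGroup E] [NormedSpace ℝ E]
    [FiniteDimensional ℝ E] [MeasurableSpace E] [BorelSpace E] (μ : Measure E) [μ.IsAddHaarMeasure]
    {r : ℝ} (hr : r ≠ 0) (f : E → ℝ≥0∞) :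
    ∫⁻ x, f (r • x) ∂μ = ENNReal.ofReal |(r ^ Module.finrank ℝ E)⁻¹| * ∫⁻ x, f x ∂μ := by
  rw [← smul_eq_mul, ← lintegral_smul_measure, ← Measure.map_addHaar_smul μ hr]
  exact ((Homeomorph.smulOfNeZero r hr).measurableEmbedding.lintegral_map f).symm

theorem eLpNorm_two_sq {α E : Type*} [MeasurableSpace α] [NormedAddCommGroup E] (μ : Measure α)
    (f : α → E) : eLpNorm f 2 μ ^ 2 = ∫⁻ x, ‖f x‖ₑ ^ 2 ∂μ := by
  have := eLpNorm_nnreal_pow_eq_lintegral (f := f) (μ := μ) (p := 2) two_ne_zero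
  simpa using this

theorem integrable_exp_neg_norm_sub_sq {n : ℕ} {b : ℝ} (hb : 0 < b) (x : Rn n) :
    Integrable (fun y => Real.exp (-b * ‖x - y‖ ^ 2)) volume := by
  have := (GaussianFourier.integrable_cexp_neg_mul_sq_norm_add (V := Rn n) (b := b)
    (by simpa using hb) 0 0).norm
  have h2 : Integrable (fun y : Rn n => Real.exp (-b * ‖y‖ ^ 2)) volume := by
    refine this.congr (Filter.Eventually.of_forall fun y => ?_)
    simp [Complex.norm_exp, ← Complex.ofReal_pow]
  exact h2.comp_sub_left x

/-- The FBI transform maps `L²(ℝⁿ)` to `L²(ℝ²ⁿ)`. -/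
theorem memLp_fbiReal {n : ℕ} {h : ℝ} (hh : 0 < h) {v : Rn n → ℂ} (hv : MemLp v 2 volume) :
    MemLp (fbiReal h v) 2 volume := by
  have hC : Continuous (toC (n := n)) := by unfold toC; fun_prop
  have hm : StronglyMeasurable (fbiReal h v) :=
    stronglyMeasurable_fbi h hv.1 (hC.comp continuous_fst) (hC.comp continuous_snd)
  refine ⟨hm.aestronglyMeasurable, ?_⟩
  set K := ‖fbiConst n * h ^ (-(3 * (n : ℝ) / 4))‖ₑ
  have hK : K ^ 2 ≠ ⊤ := ENNReal.pow_ne_top enorm_ne_top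
  set r := (2 * Real.pi * h)⁻¹
  have hr : r ≠ 0 := by have := Real.pi_pos; positivity
  set R := ENNReal.ofReal |(r ^ Module.finrank ℝ (Rn n))⁻¹|
  have hR : R ≠ ⊤ := ENNReal.ofReal_ne_top
  set W : Rn n → Rn n → ℂ := fun x y => Complex.exp ((-‖x - y‖ ^ 2 / (2 * h) : ℝ)) * v y
  have hW : ∀ x y, ‖W x y‖ₑ ^ 2 = ENNReal.ofReal (Real.exp (-h⁻¹ * ‖x - y‖ ^ 2)) * ‖v y‖ₑ ^ 2 := by
    intro x y
    simp only [W]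
    rw [enorm_mul, mul_pow, ← Complex.ofReal_exp, ← ofReal_norm, Complex.norm_real,
      Real.norm_of_nonneg (Real.exp_nonneg _), ← ENNReal.ofReal_pow (Real.exp_nonneg _),
      ← Real.exp_nat_mul]
    congr 3
    push_cast
    field_simp
  have hcont : ∀ x, Continuous fun y : Rn n => Complex.exp ((-‖x - y‖ ^ 2 / (2 * h) : ℝ)) := by
    intro x; fun_prop
  have hW2 : ∀ x, MemLp (W x) 2 volume := by
    intro x
    refine hv.mono ((hcont x).aestronglyMeasurable.mul hv.1) (Filter.Eventually.of_forall fun y => ?_)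
    simp only [W]
    rw [norm_mul, ← Complex.ofReal_exp, Complex.norm_real, Real.norm_of_nonneg (Real.exp_nonneg _)]
    refine mul_le_of_le_one_left (norm_nonneg _) (Real.exp_le_one_iff.2 ?_)
    rw [neg_div]
    exact neg_nonpos.2 (by positivity)
  have hW1 : ∀ x, Integrable (W x) volume := by
    intro x
    have hg : MemLp (fun y : Rn n => Complex.exp ((-‖x - y‖ ^ 2 / (2 * h) : ℝ))) 2 volume := by
      rw [memLp_two_iff_integrable_sq_norm (hcont x).aestronglyMeasurable]
      refine (integrable_exp_neg_norm_sub_sq (inv_pos.2 hh) x).congr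
        (Filter.Eventually.of_forall fun y => ?_)
      simp only
      rw [← Complex.ofReal_exp, Complex.norm_real, Real.norm_of_nonneg (Real.exp_nonneg _),
        ← Real.exp_nat_mul]
      congr 1
      push_cast
      field_simp
    exact hg.integrable_mul hv
  -- Plancherel at fixed `x`, after rescaling `ξ`. Integrating in `x` then leaves a Gaussian
  -- integral independent of `y`.
  have hinner : ∀ x, ∫⁻ ξ, ‖fbiReal h v (x, ξ)‖ₑ ^ 2 = K ^ 2 * (R * ∫⁻ y, ‖W x y‖ₑ ^ 2) := by
    intro x
    have h1 : ∀ ξ, ‖fbiReal h v (x, ξ)‖ₑ ^ 2 = K ^ 2 * ‖𝓕 (W x) (r • ξ)‖ₑ ^ 2 := fun ξ => by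
      rw [enorm_fbiReal hh, mul_pow]
    simp only [h1]
    rw [lintegral_const_mul' _ _ hK,
      lintegral_comp_smul_eq volume hr (fun ξ => ‖𝓕 (W x) ξ‖ₑ ^ 2), ← eLpNorm_two_sq,
      eLpNorm_fourier_eq (hW1 x) (hW2 x), eLpNorm_two_sq]
  have hfin : eLpNorm (fbiReal h v) 2 volume ^ 2 < ⊤ := by
    rw [eLpNorm_two_sq, Measure.volume_eq_prod,
      lintegral_prod _ (hm.enorm.pow_const 2).aemeasurable]
    simp only [hinner]
    rw [lintegral_const_mul' _ _ hK, lintegral_const_mul' _ _ hR]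
    refine ENNReal.mul_lt_top (ENNReal.pow_lt_top enorm_lt_top) (ENNReal.mul_lt_top ENNReal.ofReal_lt_top ?_)
    simp only [hW]
    rw [lintegral_lintegral_swap]
    · have h2 : ∀ y : Rn n, ∫⁻ x, ENNReal.ofReal (Real.exp (-h⁻¹ * ‖x - y‖ ^ 2)) * ‖v y‖ₑ ^ 2 =
          (∫⁻ x : Rn n, ENNReal.ofReal (Real.exp (-h⁻¹ * ‖0 - x‖ ^ 2))) * ‖v y‖ₑ ^ 2 := by
        intro y
        rw [lintegral_mul_const' _ _ (by simp)]
        congr 1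
        simp only [zero_sub, norm_neg]
        exact lintegral_sub_right_eq_self (μ := (volume : Measure (Rn n)))
          (fun x => ENNReal.ofReal (Real.exp (-h⁻¹ * ‖x‖ ^ 2))) y
      simp only [h2]
      have h3 := (integrable_exp_neg_norm_sub_sq (inv_pos.2 hh) (0 : Rn n)).lintegral_lt_top
      rw [lintegral_const_mul' _ _ h3.ne, ← eLpNorm_two_sq]
      exact ENNReal.mul_lt_top h3 (ENNReal.pow_lt_top hv.2)
    · have hE : Continuous fun q : Rn n × Rn n =>
          ENNReal.ofReal (Real.exp (-h⁻¹ * ‖q.1 - q.2‖ ^ 2)) :=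
        ENNReal.continuous_ofReal.comp (by fun_prop)
      exact hE.aemeasurable.mul (hv.1.enorm.pow_const 2).comp_snd
  simpa using hfin

/-! ### The gradient of `G` under the `C²` bound -/

/-- The Euclidean inner product of `ℝ²ⁿ`. -/
def pdot {n : ℕ} (p q : PhaseSpace n) : ℝ := ∑ j, (p.1 j * q.1 j + p.2 j * q.2 j)

theorem pdot_eq_inner {n : ℕ} (p q : PhaseSpace n) :
    pdot p q = inner ℝ p.1 q.1 + inner ℝ p.2 q.2 := by
  simp [pdot, PiLp.inner_apply, Finset.sum_add_distrib, mul_comm]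

theorem norm_sq_le_pdot {n : ℕ} (p : PhaseSpace n) : ‖p‖ ^ 2 ≤ pdot p p := by
  rw [pdot_eq_inner, real_inner_self_eq_norm_sq, real_inner_self_eq_norm_sq, Prod.norm_def]
  rcases max_choice ‖p.1‖ ‖p.2‖ with h | h <;> rw [h] <;>
    nlinarith [sq_nonneg ‖p.1‖, sq_nonneg ‖p.2‖]

/-- The Euclidean gradient `(G_x, G_ξ)`. -/
def grad {n : ℕ} (G : PhaseSpace n → ℝ) (q : PhaseSpace n) : PhaseSpace n :=
  (WithLp.toLp 2 (dX G q), WithLp.toLp 2 (dXi G q))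

@[simp] theorem grad_fst {n : ℕ} (G : PhaseSpace n → ℝ) (q : PhaseSpace n) (j : Fin n) :
    (grad G q).1 j = dX G q j := rfl

@[simp] theorem grad_snd {n : ℕ} (G : PhaseSpace n → ℝ) (q : PhaseSpace n) (j : Fin n) :
    (grad G q).2 j = dXi G q j := rfl

theorem fderiv_eq_pdot {n : ℕ} (G : PhaseSpace n → ℝ) (q w : PhaseSpace n) :
    fderiv ℝ G q w = pdot (grad G q) w := by
  have hw : w = ∑ j, (w.1 j • ((EuclideanSpace.single j 1, 0) : PhaseSpace n) +
      w.2 j • ((0, EuclideanSpace.single j 1) : PhaseSpace n)) := by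
    ext k
    · simp [Prod.fst_sum, Pi.single_apply]
    · simp [Prod.snd_sum, Pi.single_apply]
  conv_lhs => rw [hw]
  simp only [map_sum, map_add, map_smul, smul_eq_mul, pdot, grad_fst, grad_snd, dX, dXi, mul_comm]

theorem norm_fderiv_sub_le {n : ℕ} {G : PhaseSpace n → ℝ} (hG : ContDiff ℝ ∞ G)
    (hc : HasCompactSupport G) {ε : ℝ} (hε : C2norm G < ε) (a b : PhaseSpace n) :
    ‖fderiv ℝ G a - fderiv ℝ G b‖ ≤ ε * ‖a - b‖ := by
  -- Without boundedness the real supremum would default to 0 and control nothing.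
  have hbdd : BddAbove (Set.range fun p => ‖iteratedFDeriv ℝ 2 G p‖) :=
    ((hG.continuous_iteratedFDeriv (m := 2)
      (WithTop.coe_le_coe.2 (le_top : (2 : ℕ∞) ≤ ⊤))).norm).bddAbove_range_of_hasCompactSupport (hc.iteratedFDeriv 2).norm
  have h2 : ∀ p, ‖iteratedFDeriv ℝ 2 G p‖ ≤ ε := by
    intro p
    refine (le_ciSup hbdd p).trans (le_trans ?_ hε.le)
    exact Finset.single_le_sum (f := fun k => ⨆ p, ‖iteratedFDeriv ℝ k G p‖)
      (fun k _ => Real.iSup_nonneg fun _ => norm_nonneg _) (by simp : 2 ∈ Finset.range 3)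
  have hd : ContDiff ℝ 1 (fderiv ℝ G) := hG.fderiv_right (by norm_cast)
  refine Convex.norm_image_sub_le_of_norm_fderiv_le (𝕜 := ℝ)
    (fun x _ => hd.differentiable one_ne_zero x) (fun x _ => ?_) convex_univ
    (Set.mem_univ b) (Set.mem_univ a)
  rw [← norm_iteratedFDeriv_one, norm_iteratedFDeriv_fderiv]
  exact h2 x

/-- The mean value inequality on the segment gives `ε` instead of the sharp `ε/2`, which suffices
here. -/
theorem abs_taylor_le {n : ℕ} {G : PhaseSpace n → ℝ} (hG : ContDiff ℝ ∞ G) {ε : ℝ} (hε : 0 ≤ ε)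
    (hL : ∀ a b, ‖fderiv ℝ G a - fderiv ℝ G b‖ ≤ ε * ‖a - b‖) (a b : PhaseSpace n) :
    |G b - G a - pdot (grad G a) (b - a)| ≤ ε * pdot (b - a) (b - a) := by
  rw [← fderiv_eq_pdot, ← Real.norm_eq_abs]
  have h := (convex_segment a b).norm_image_sub_le_of_norm_fderiv_le' (𝕜 := ℝ) (f := G)
    (φ := fderiv ℝ G a) (C := ε * ‖b - a‖)
    (fun x _ => (hG.differentiable (by simp)) x) (fun x hx => ?_)
    (left_mem_segment ℝ a b) (right_mem_segment ℝ a b)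
  · refine h.trans ?_
    rw [mul_assoc, ← sq]
    exact mul_le_mul_of_nonneg_left (norm_sq_le_pdot _) hε
  · refine (hL x a).trans (mul_le_mul_of_nonneg_left ?_ hε)
    obtain ⟨t, ht, rfl⟩ := segment_eq_image' ℝ a b ▸ hx
    rw [add_sub_cancel_left, norm_smul, Real.norm_of_nonneg ht.1]
    exact mul_le_of_le_one_left (norm_nonneg _) ht.2

/-- The norm on phase space is the maximum of two Euclidean norms, so testing the functional on `(v,
0)` and `(0, v)` bounds each component of the gradient difference. -/
theorem norm_grad_sub_le {n : ℕ} {G : PhaseSpace n → ℝ} {ε : ℝ}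
    (hL : ∀ a b, ‖fderiv ℝ G a - fderiv ℝ G b‖ ≤ ε * ‖a - b‖) (a b : PhaseSpace n) :
    ‖grad G a - grad G b‖ ≤ ε * ‖a - b‖ := by
  have hpos : 0 ≤ ε * ‖a - b‖ := (norm_nonneg _).trans (hL a b)
  have hw : ∀ w : PhaseSpace n, pdot (grad G a - grad G b) w ≤ ε * ‖a - b‖ * ‖w‖ := by
    intro w
    have h1 : pdot (grad G a - grad G b) w = (fderiv ℝ G a - fderiv ℝ G b) w := by
      rw [sub_apply, fderiv_eq_pdot, fderiv_eq_pdot]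
      simp only [pdot_eq_inner, Prod.fst_sub, Prod.snd_sub, inner_sub_left]
      ring
    rw [h1]
    exact (le_abs_self _).trans (((fderiv ℝ G a - fderiv ℝ G b).le_opNorm w).trans
      (mul_le_mul_of_nonneg_right (hL a b) (norm_nonneg _)))
  have aux : ∀ v : Rn n, ‖v‖ ^ 2 ≤ ε * ‖a - b‖ * ‖v‖ → ‖v‖ ≤ ε * ‖a - b‖ := by
    intro v hv
    rcases (norm_nonneg v).eq_or_lt with h | h
    · rwa [← h]
    · rw [sq] at hv
      exact le_of_mul_le_mul_right hv h
  rw [Prod.norm_def]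
  refine max_le (aux _ ?_) (aux _ ?_)
  · have := hw ((grad G a - grad G b).1, 0)
    simpa [pdot_eq_inner, Prod.norm_def] using this
  · have := hw (0, (grad G a - grad G b).2)
    simpa [pdot_eq_inner, Prod.norm_def] using this

theorem contDiff_grad {n : ℕ} {G : PhaseSpace n → ℝ} (hG : ContDiff ℝ ∞ G) :
    ContDiff ℝ ∞ (grad G) := by
  have h1 : ContDiff ℝ ∞ (fderiv ℝ G) := hG.fderiv_right (by norm_cast)
  refine ContDiff.prodMk (contDiff_euclidean.2 fun j => ?_) (contDiff_euclidean.2 fun j => ?_) <;>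
  exact h1.clm_apply contDiff_const

/-! ### The diffeomorphism `κ` -/

/-- The map `q ↦ q - ∇G(q)`. -/
def kap {n : ℕ} (G : PhaseSpace n → ℝ) (q : PhaseSpace n) : PhaseSpace n := q - grad G q

theorem contDiff_kap {n : ℕ} {G : PhaseSpace n → ℝ} (hG : ContDiff ℝ ∞ G) :
    ContDiff ℝ ∞ (kap G) := contDiff_id.sub (contDiff_grad hG)

theorem norm_fderiv_grad_le {n : ℕ} {G : PhaseSpace n → ℝ} {ε : ℝ} (hε : 0 ≤ ε)
    (hL : ∀ a b, ‖fderiv ℝ G a - fderiv ℝ G b‖ ≤ ε * ‖a - b‖) (q : PhaseSpace n) :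
    ‖fderiv ℝ (grad G) q‖ ≤ ε := by
  have : LipschitzWith ⟨ε, hε⟩ (grad G) := LipschitzWith.of_dist_le_mul fun a b => by
    rw [dist_eq_norm, dist_eq_norm]; exact norm_grad_sub_le hL a b
  exact norm_fderiv_le_of_lipschitz ℝ this

theorem hasFDerivAt_kap {n : ℕ} {G : PhaseSpace n → ℝ} (hG : ContDiff ℝ ∞ G) (q : PhaseSpace n) :
    HasFDerivAt (kap G) (1 - fderiv ℝ (grad G) q) q :=
  (hasFDerivAt_id q).sub (((contDiff_grad hG).differentiable (by simp)) q).hasFDerivAt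

/-- `κ` is a contraction perturbation of the identity, hence a global homeomorphism; its derivative
is invertible by the Neumann series, so the inverse is smooth. -/
theorem exists_kap_homeomorph {n : ℕ} {G : PhaseSpace n → ℝ} (hG : ContDiff ℝ ∞ G)
    (hL : ∀ a b, ‖fderiv ℝ G a - fderiv ℝ G b‖ ≤ 1 / 4 * ‖a - b‖) :
    ∃ e : PhaseSpace n ≃ₜ PhaseSpace n, (∀ q, e q = kap G q) ∧ ContDiff ℝ ∞ e.symm := by
  have happ : ApproximatesLinearOn (kap G)
      ((ContinuousLinearEquiv.refl ℝ (PhaseSpace n) : PhaseSpace n ≃L[ℝ] PhaseSpace n) :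
        PhaseSpace n →L[ℝ] PhaseSpace n) Set.univ (1 / 4) := by
    intro a _ b _
    have : kap G a - kap G b - (a - b) = -(grad G a - grad G b) := by simp only [kap]; abel
    simp only [ContinuousLinearEquiv.coe_refl, ContinuousLinearMap.coe_id', id]
    rw [this, norm_neg]
    simpa using norm_grad_sub_le hL a b
  have hc : Subsingleton (PhaseSpace n) ∨ (1 / 4 : ℝ≥0) <
      ‖((ContinuousLinearEquiv.refl ℝ (PhaseSpace n)).symm :
        PhaseSpace n →L[ℝ] PhaseSpace n)‖₊⁻¹ := by
    -- For `n = 0` the identity has norm 0, so this case is separate.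
    rcases subsingleton_or_nontrivial (PhaseSpace n) with h | h
    · exact Or.inl h
    · right
      have : ‖((ContinuousLinearEquiv.refl ℝ (PhaseSpace n)).symm :
          PhaseSpace n →L[ℝ] PhaseSpace n)‖₊ = 1 := by
        simp [ContinuousLinearEquiv.refl_symm]
      rw [this, inv_one]
      exact NNReal.coe_lt_coe.1 (by norm_num)
  refine ⟨happ.toHomeomorph _ hc, fun q => rfl, ?_⟩
  have hu : ∀ q, ‖fderiv ℝ (grad G) q‖ < 1 := fun q =>
    (norm_fderiv_grad_le (by norm_num) hL q).trans_lt (by norm_num)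
  refine Homeomorph.contDiff_symm (f₀' := fun q =>
    ContinuousLinearEquiv.unitsEquiv ℝ (PhaseSpace n) (Units.oneSub _ (hu q))) _ (fun q => ?_)
    (contDiff_kap hG)
  exact hasFDerivAt_kap hG q

/-! ### Determinant bounds -/

/-- `|det A|` is the volume ratio of the image of the unit ball, which lies in the ball of radius
`c`. -/
theorem abs_det_le_pow {E : Type*} [NormedAddCommGroup E] [NormedSpace ℝ E]
    [FiniteDimensional ℝ E] [MeasurableSpace E] [BorelSpace E] (μ : Measure E) [μ.IsAddHaarMeasure]
    (A : E →L[ℝ] E) {c : ℝ} (hc : 0 < c) (hA : ∀ w, ‖A w‖ ≤ c * ‖w‖) :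
    |A.det| ≤ c ^ Module.finrank ℝ E := by
  have h1 : A '' Metric.closedBall 0 1 ⊆ Metric.closedBall 0 c := by
    rintro _ ⟨w, hw, rfl⟩
    rw [mem_closedBall_zero_iff] at hw ⊢
    exact (hA w).trans (mul_le_of_le_one_right hc.le hw)
  have h2 := measure_mono (μ := μ) h1
  rw [Measure.addHaar_image_continuousLinearMap, Measure.addHaar_closedBall' μ 0 hc.le] at h2
  have h3 : μ (Metric.closedBall (0 : E) 1) ≠ 0 :=
    (Metric.measure_closedBall_pos μ 0 one_pos).ne'
  have h4 : μ (Metric.closedBall (0 : E) 1) ≠ ⊤ := measure_closedBall_lt_top.ne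
  rw [ENNReal.mul_le_mul_iff_left h3 h4] at h2
  exact (ENNReal.ofReal_le_ofReal_iff (by positivity)).1 h2

theorem inv_pow_le_abs_det {E : Type*} [NormedAddCommGroup E] [NormedSpace ℝ E]
    [FiniteDimensional ℝ E] [MeasurableSpace E] [BorelSpace E] (μ : Measure E) [μ.IsAddHaarMeasure]
    (A : E →L[ℝ] E) {c : ℝ} (hc : 0 < c) (hA : ∀ w, ‖w‖ ≤ c * ‖A w‖) :
    (c ^ Module.finrank ℝ E)⁻¹ ≤ |A.det| := by
  have h1 : Metric.closedBall 0 c⁻¹ ⊆ A '' Metric.closedBall 0 1 := by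
    intro w hw
    have hinj : Function.Injective A.toLinearMap := by
      refine (injective_iff_map_eq_zero _).2 fun x hx => ?_
      have := hA x
      rw [show A x = 0 from hx, norm_zero, mul_zero] at this
      exact norm_le_zero_iff.1 this
    obtain ⟨x, rfl⟩ := LinearMap.surjective_of_injective hinj w
    refine ⟨x, ?_, rfl⟩
    rw [mem_closedBall_zero_iff] at hw ⊢
    refine (hA x).trans ((mul_le_mul_of_nonneg_left hw hc.le).trans_eq (mul_inv_cancel₀ hc.ne'))
  have h2 := measure_mono (μ := μ) h1
  rw [Measure.addHaar_image_continuousLinearMap,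
    Measure.addHaar_closedBall' μ 0 (inv_pos.2 hc).le] at h2
  have h3 : μ (Metric.closedBall (0 : E) 1) ≠ 0 :=
    (Metric.measure_closedBall_pos μ 0 one_pos).ne'
  have h4 : μ (Metric.closedBall (0 : E) 1) ≠ ⊤ := measure_closedBall_lt_top.ne
  rw [ENNReal.mul_le_mul_iff_left h3 h4, inv_pow] at h2
  exact (ENNReal.ofReal_le_ofReal_iff (abs_nonneg _)).1 h2

/-! ### Critical values, matching of densities, and the maximum -/

/-- The value at the critical point in `y` of the sum of the two phases. -/
theorem isCriticalValue_iff {n : ℕ} (x ξ z ζ : Fin n → ℂ) (s : ℂ) :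
    IsCriticalValue (fun y => phase x ξ y + adjPhase z ζ y) s ↔
      s = ∑ j, ((x j - z j) * (ξ j + ζ j) / 2 +
        Complex.I / 4 * ((x j - z j) ^ 2 + (ξ j - ζ j) ^ 2)) := by
  have hf : (fun y => phase x ξ y + adjPhase z ζ y) = fun y => ∑ j,
      ((x j - y j) * ξ j + (y j - z j) * ζ j +
        Complex.I / 2 * ((x j - y j) ^ 2 + (z j - y j) ^ 2)) := by
    funext y
    simp only [phase, adjPhase, Finset.mul_sum, ← Finset.sum_add_distrib]
    exact Finset.sum_congr rfl fun j _ => by ring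
  have hd : ∀ y : Fin n → ℂ, HasFDerivAt (fun y => phase x ξ y + adjPhase z ζ y)
      (∑ j, (-ξ j + ζ j - Complex.I * ((x j - y j) + (z j - y j))) •
        (ContinuousLinearMap.proj j : (Fin n → ℂ) →L[ℂ] ℂ)) y := by
    intro y
    rw [hf]
    refine HasFDerivAt.fun_sum fun j _ => ?_
    have h1 : HasDerivAt (fun t : ℂ => (x j - t) * ξ j + (t - z j) * ζ j +
        Complex.I / 2 * ((x j - t) ^ 2 + (z j - t) ^ 2))
        (-ξ j + ζ j - Complex.I * ((x j - y j) + (z j - y j))) (y j) := by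
      have ht := hasDerivAt_id (y j)
      have := (((ht.const_sub (x j)).mul_const (ξ j)).add ((ht.sub_const (z j)).mul_const (ζ j))).add
        ((((ht.const_sub (x j)).pow 2).add ((ht.const_sub (z j)).pow 2)).const_mul
          (Complex.I / 2))
      convert! this using 1
      simp
      ring
    exact h1.comp_hasFDerivAt y (ContinuousLinearMap.proj j : (Fin n → ℂ) →L[ℂ] ℂ).hasFDerivAt
  have hcrit : ∀ y : Fin n → ℂ, HasFDerivAt (fun y => phase x ξ y + adjPhase z ζ y)
      (0 : (Fin n → ℂ) →L[ℂ] ℂ) y ↔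
      ∀ j, y j = (x j + z j) / 2 - Complex.I * (ξ j - ζ j) / 2 := by
    intro y
    have hj : ∀ j, -ξ j + ζ j - Complex.I * ((x j - y j) + (z j - y j)) = 0 ↔
        y j = (x j + z j) / 2 - Complex.I * (ξ j - ζ j) / 2 := by
      intro j
      constructor <;> intro h
      · linear_combination (-Complex.I / 2) * h +
          (-(x j + z j - 2 * y j) / 2) * Complex.I_sq
      · rw [h]; linear_combination (-(ξ j - ζ j)) * Complex.I_sq
    simp only [← hj]
    constructor
    · intro h j
      have := DFunLike.congr_fun (h.unique (hd y)) (Pi.single j 1)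
      simpa [Pi.single_apply] using this.symm
    · intro h
      have hy := hd y
      rwa [Finset.sum_eq_zero fun j _ => by ext w; simp [h j]] at hy
  have hval : ∀ y : Fin n → ℂ, (∀ j, y j = (x j + z j) / 2 - Complex.I * (ξ j - ζ j) / 2) →
      phase x ξ y + adjPhase z ζ y = ∑ j, ((x j - z j) * (ξ j + ζ j) / 2 +
        Complex.I / 4 * ((x j - z j) ^ 2 + (ξ j - ζ j) ^ 2)) := by
    intro y hy
    rw [congrFun hf y]
    refine Finset.sum_congr rfl fun j _ => ?_
    rw [hy j]
    linear_combination (Complex.I / 4 * (ξ j - ζ j) ^ 2) * Complex.I_sq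
  constructor
  · rintro ⟨y, hy, rfl⟩
    exact hval y ((hcrit y).1 hy)
  · rintro rfl
    exact ⟨fun j => (x j + z j) / 2 - Complex.I * (ξ j - ζ j) / 2, (hcrit _).2 fun _ => rfl,
      hval _ fun _ => rfl⟩

/-- The phase is quadratic in `y` with one critical point, so each `q` contributes one real value,
written here through `∇G(q)`. -/
theorem weightValues_eq_range {n : ℕ} (G : PhaseSpace n → ℝ) (p : PhaseSpace n) :
    weightValues G p = Set.range fun q => G q + pdot (grad G q) (p - q) / 2 +
      pdot (grad G q) (grad G q) / 4 - pdot (p - q) (p - q) / 4 := by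
  have key : ∀ q : PhaseSpace n,
      -(∑ j, ((toC p.1 j - lamZ G q j) * (toC p.2 j + lamZeta G q j) / 2 + Complex.I / 4 *
        ((toC p.1 j - lamZ G q j) ^ 2 + (toC p.2 j - lamZeta G q j) ^ 2))).im + weightH G q =
      G q + pdot (grad G q) (p - q) / 2 + pdot (grad G q) (grad G q) / 4 -
        pdot (p - q) (p - q) / 4 := by
    intro q
    rw [Complex.im_sum, weightH]
    simp only [pdot, Finset.sum_div, ← Finset.sum_neg_distrib]
    rw [add_sub_left_comm, ← Finset.sum_sub_distrib, add_assoc, add_sub_assoc,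
      ← Finset.sum_add_distrib, ← Finset.sum_sub_distrib]
    congr 1
    refine Finset.sum_congr rfl fun j _ => ?_
    have e1 : (toC p.1 j - lamZ G q j) * (toC p.2 j + lamZeta G q j) / 2 + Complex.I / 4 *
        ((toC p.1 j - lamZ G q j) ^ 2 + (toC p.2 j - lamZeta G q j) ^ 2) =
        (((p.1 j - q.1 j) * (p.2 j + q.2 j) / 2 - dXi G q j * dX G q j / 2 +
          (p.1 j - q.1 j) * dXi G q j / 2 - (p.2 j - q.2 j) * dX G q j / 2 : ℝ) : ℂ) +
        ((-(p.1 j - q.1 j) * dX G q j / 2 - dXi G q j * (p.2 j + q.2 j) / 2 +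
          ((p.1 j - q.1 j) ^ 2 - dXi G q j ^ 2 + (p.2 j - q.2 j) ^ 2 - dX G q j ^ 2) / 4 : ℝ) : ℂ)
          * Complex.I := by
      simp only [toC, lamZ, lamZeta]
      push_cast
      ring_nf
      simp only [Complex.I_sq, Complex.I_pow_three]
      ring
    rw [e1, Complex.add_im, Complex.ofReal_im, Complex.im_ofReal_mul, Complex.I_im]
    simp only [Prod.fst_sub, Prod.snd_sub, PiLp.sub_apply, grad_fst, grad_snd]
    ring
  ext r
  simp only [weightValues, Set.mem_ofPred_eq, isCriticalValue_iff, Set.mem_range]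
  constructor
  · rintro ⟨q, s, rfl, rfl⟩
    exact ⟨q, (key q).symm⟩
  · rintro ⟨q, rfl⟩
    exact ⟨q, _, rfl, (key q).symm⟩

theorem enorm_cexp_neg_sum_sq {n : ℕ} (h : ℝ) (ζ : Fin n → ℂ) :
    ‖Complex.exp (-(∑ j, ζ j ^ 2) / (2 * h))‖ₑ ^ 2 =
      ENNReal.ofReal (Real.exp (-(∑ j, ((ζ j).re ^ 2 - (ζ j).im ^ 2)) / h)) := by
  rw [← ofReal_norm, Complex.norm_exp, ← ENNReal.ofReal_pow (Real.exp_nonneg _),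
    ← Real.exp_nat_mul]
  have h1 : (∑ j, ζ j ^ 2).re = ∑ j, ((ζ j).re ^ 2 - (ζ j).im ^ 2) := by
    rw [Complex.re_sum]
    exact Finset.sum_congr rfl fun j _ => by rw [sq, Complex.mul_re]; ring
  have h2 : (-(∑ j, ζ j ^ 2) / (2 * h)) = -(∑ j, ζ j ^ 2) / ((2 * h : ℝ) : ℂ) := by push_cast; rfl
  rw [h2, Complex.div_ofReal_re, Complex.neg_re, h1]
  congr 2
  rw [neg_div, neg_div, ← div_div, div_right_comm]
  push_cast
  ring

/-- The densities of the two weighted norms agree pointwise under `q ↦ q - ∇G(q)`. -/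
theorem enorm_fbiLam_sq_mul {n : ℕ} (G : PhaseSpace n → ℝ) {h : ℝ} (hh : 0 < h) (v : Rn n → ℂ)
    (q : PhaseSpace n) :
    ENNReal.ofReal (Real.exp (-(2 * weightH G q) / h)) * ‖fbiLam G h v q‖ₑ ^ 2 =
      ENNReal.ofReal (Real.exp (-(2 * (G q - pdot (grad G q) (grad G q) / 2)) / h)) *
        ‖fbiReal h v (kap G q)‖ₑ ^ 2 := by
  rw [fbiLam, fbiReal, fbi_eq_gaussTransform hh.ne', fbi_eq_gaussTransform hh.ne']
  have hw : (fun j => lamZ G q j - Complex.I * lamZeta G q j) =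
      fun j => toC (kap G q).1 j - Complex.I * toC (kap G q).2 j := by
    funext j
    simp only [lamZ, lamZeta, toC, kap, Prod.fst_sub, Prod.snd_sub, PiLp.sub_apply, grad_fst,
      grad_snd]
    push_cast
    linear_combination (dX G q j : ℂ) * Complex.I_sq
  rw [hw]
  generalize ((fbiConst n * h ^ (-(3 * (n : ℝ) / 4)) : ℝ) : ℂ) * gaussTransform h v _ = b
  rw [enorm_mul, enorm_mul, mul_pow, mul_pow, ← mul_assoc, ← mul_assoc]
  congr 1
  rw [enorm_cexp_neg_sum_sq, enorm_cexp_neg_sum_sq, ← ENNReal.ofReal_mul (Real.exp_nonneg _),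
    ← ENNReal.ofReal_mul (Real.exp_nonneg _), ← Real.exp_add, ← Real.exp_add, ← add_div, ← add_div]
  congr 3
  have e1 : ∀ j, (lamZeta G q j).re ^ 2 - (lamZeta G q j).im ^ 2 = q.2 j ^ 2 - dX G q j ^ 2 := by
    intro j; simp [lamZeta]
  have e2 : ∀ j, (toC (kap G q).2 j).re ^ 2 - (toC (kap G q).2 j).im ^ 2 =
      (q.2 j - dXi G q j) ^ 2 := by
    intro j; simp [toC, kap]
  simp only [e1, e2, weightH, pdot, grad_fst, grad_snd]
  have e3 : ∑ j, (q.2 j - dXi G q j) ^ 2 = ∑ j, (q.2 j ^ 2 - dX G q j ^ 2) -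
      2 * ∑ j, q.2 j * dXi G q j + ∑ j, (dX G q j * dX G q j + dXi G q j * dXi G q j) := by
    rw [Finset.mul_sum, ← Finset.sum_sub_distrib, ← Finset.sum_add_distrib]
    exact Finset.sum_congr rfl fun j _ => by ring
  rw [e3]
  ring

instance isAddHaarMeasure_volume_phaseSpace (n : ℕ) :
    (volume : Measure (PhaseSpace n)).IsAddHaarMeasure :=
  Measure.prod.instIsAddHaarMeasure volume volume

theorem eLpNorm_expMeasure_sq {n : ℕ} {h : ℝ} {w : PhaseSpace n → ℝ} (hw : Continuous w)
    (f : PhaseSpace n → ℂ) :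
    eLpNorm f 2 (expMeasure h w) ^ 2 =
      ∫⁻ p, ENNReal.ofReal (Real.exp (-(2 * w p) / h)) * ‖f p‖ₑ ^ 2 := by
  have hm : Measurable fun p => ENNReal.ofReal (Real.exp (-(2 * w p) / h)) := by fun_prop
  rw [eLpNorm_two_sq, expMeasure, lintegral_withDensity_eq_lintegral_mul_non_measurable _ hm
    (Filter.Eventually.of_forall fun _ => ENNReal.ofReal_lt_top)]
  rfl

/-- The transport of the weight by `q ↦ q - ∇G(q)` is the maximum defining `φ`. -/
theorem isGreatest_weightValues {n : ℕ} {G : PhaseSpace n → ℝ} (hG : ContDiff ℝ ∞ G)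
    (hL : ∀ a b, ‖fderiv ℝ G a - fderiv ℝ G b‖ ≤ 1 / 4 * ‖a - b‖) (r : PhaseSpace n) :
    IsGreatest (weightValues G (kap G r)) (G r - pdot (grad G r) (grad G r) / 2) := by
  rw [weightValues_eq_range]
  constructor
  · refine ⟨r, ?_⟩
    simp only [kap, pdot_eq_inner, sub_sub_cancel_left, Prod.fst_neg,
      Prod.snd_neg, inner_neg_left, inner_neg_right]
    ring
  · rintro _ ⟨q, rfl⟩
    -- Expand `G` at `b = κ(r) + ∇G(q)` from both `q` and `r`. The constant 1/4 reproduces the term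
    -- `-|p - q|²/4` with `p = κ(r)`; since `b - r = ∇G(q) - ∇G(r)`, the two bounds leave a deficit
    -- of `|b - r|²/4`, which is `h3`.
    have h1 := (abs_le.1 (abs_taylor_le hG (by norm_num) hL q (kap G r + grad G q))).1
    have h2 := (abs_le.1 (abs_taylor_le hG (by norm_num) hL r (kap G r + grad G q))).2
    have h3 : 0 ≤ pdot (kap G r + grad G q - r) (kap G r + grad G q - r) :=
      (sq_nonneg _).trans (norm_sq_le_pdot _)
    simp only [kap, pdot_eq_inner, Prod.fst_sub, Prod.snd_sub, Prod.fst_add, Prod.snd_add,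
      inner_add_left, inner_sub_left, inner_add_right, inner_sub_right] at h1 h2 h3 ⊢
    simp only [real_inner_comm (grad G q).1, real_inner_comm (grad G q).2,
      real_inner_comm (grad G r).1 r.1, real_inner_comm (grad G r).2 r.2,
      real_inner_comm r.1 q.1, real_inner_comm r.2 q.2] at h1 h2 h3 ⊢
    linarith

end

end FBIWeights

/-! ### The norm equivalence -/

open FBIWeights

theorem mainTheorem3 (n : ℕ) :
    ∃ ε₀ : ℝ, 0 < ε₀ ∧ ∃ C₀ : ℝ≥0, 0 < C₀ ∧
      ∀ G : FBIWeights.PhaseSpace n → ℝ, ContDiff ℝ ∞ G → HasCompactSupport G →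
        FBIWeights.C2norm G < ε₀ →
        ∃ φ : FBIWeights.PhaseSpace n → ℝ, ContDiff ℝ ∞ φ ∧ HasCompactSupport φ ∧
          (∀ p : FBIWeights.PhaseSpace n, IsGreatest (FBIWeights.weightValues G p) (φ p)) ∧
          ∀ h : ℝ, 0 < h → ∀ v : FBIWeights.Rn n → ℂ, MemLp v 2 volume →
            MemLp (FBIWeights.fbiLam G h v) 2
              (FBIWeights.expMeasure h (FBIWeights.weightH G)) ∧
            MemLp (FBIWeights.fbiReal h v) 2 (FBIWeights.expMeasure h φ) ∧
            eLpNorm (FBIWeights.fbiLam G h v) 2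
                (FBIWeights.expMeasure h (FBIWeights.weightH G)) / (C₀ : ℝ≥0∞) ≤
              eLpNorm (FBIWeights.fbiReal h v) 2 (FBIWeights.expMeasure h φ) ∧
            eLpNorm (FBIWeights.fbiReal h v) 2 (FBIWeights.expMeasure h φ) ≤
              (C₀ : ℝ≥0∞) * eLpNorm (FBIWeights.fbiLam G h v) 2
                (FBIWeights.expMeasure h (FBIWeights.weightH G)) := by
  -- The Jacobian lies between `2^{-2n}` and `2^{2n}`; the square root gives `2^n`.
  refine ⟨1 / 4, by norm_num, 2 ^ n, by positivity, fun G hG hc hε => ?_⟩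
  have hL := norm_fderiv_sub_le hG hc hε
  obtain ⟨e, he, hes⟩ := exists_kap_homeomorph hG hL
  have hgrad := contDiff_grad hG
  have hg1 : ∀ j, ContDiff ℝ ∞ fun q => dX G q j :=
    fun j => contDiff_euclidean.1 hgrad.fst j
  have hg2 : ∀ j, ContDiff ℝ ∞ fun q => dXi G q j :=
    fun j => contDiff_euclidean.1 hgrad.snd j
  set φ : PhaseSpace n → ℝ := fun p =>
    G (e.symm p) - pdot (grad G (e.symm p)) (grad G (e.symm p)) / 2 with hφ_def
  have hφ : ContDiff ℝ ∞ φ := by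
    have h1 : ContDiff ℝ ∞ fun q => G q - pdot (grad G q) (grad G q) / 2 := by
      refine hG.sub (ContDiff.div_const (ContDiff.sum fun j _ => ?_) 2)
      exact ((hg1 j).mul (hg1 j)).add ((hg2 j).mul (hg2 j))
    exact h1.comp hes
  have hφc : HasCompactSupport φ := by
    refine HasCompactSupport.intro hc fun p hp => ?_
    -- Off the support of `G` the gradient vanishes, so `κ` fixes `p` and `φ(p) = 0`.
    have hD : fderiv ℝ G p = 0 := by
      by_contra hne
      exact hp (support_fderiv_subset ℝ hne)
    have hg : grad G p = 0 := by
      ext j <;> simp [dX, dXi, hD]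
    have hsymm : e.symm p = p := by
      rw [e.symm_apply_eq, he, kap, hg, sub_zero]
    simp only [hφ_def, hsymm, hg, image_eq_zero_of_notMem_tsupport hp]
    simp [pdot]
  have hφe : ∀ q, φ (kap G q) = G q - pdot (grad G q) (grad G q) / 2 := fun q => by
    simp only [hφ_def, ← he, e.symm_apply_apply]
  refine ⟨φ, hφ, hφc, fun p => ?_, fun h hh v hv => ?_⟩
  · obtain ⟨q, rfl⟩ := e.surjective p
    rw [he, hφe]
    exact isGreatest_weightValues hG hL q
  have hH : Continuous (weightH G) := by
    refine hG.continuous.sub (continuous_finsetSum _ fun j _ => ?_)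
    have := (hg2 j).continuous
    fun_prop
  have hZ : Continuous (lamZ G) := continuous_pi fun j => by
    have := (hg2 j).continuous
    unfold lamZ
    fun_prop
  have hZeta : Continuous (lamZeta G) := continuous_pi fun j => by
    have := (hg1 j).continuous
    unfold lamZeta
    fun_prop
  have hA := eLpNorm_expMeasure_sq (h := h) hH (fbiLam G h v)
  have hB := eLpNorm_expMeasure_sq (h := h) hφ.continuous (fbiReal h v)
  set A := eLpNorm (fbiLam G h v) 2 (expMeasure h (weightH G))
  set B := eLpNorm (fbiReal h v) 2 (expMeasure h φ)
  set g : PhaseSpace n → ℝ≥0∞ := fun p =>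
    ENNReal.ofReal (Real.exp (-(2 * φ p) / h)) * ‖fbiReal h v p‖ₑ ^ 2
  have hA' : A ^ 2 = ∫⁻ q, g (kap G q) := by
    rw [hA]
    refine lintegral_congr fun q => ?_
    rw [enorm_fbiLam_sq_mul G hh v q, ← hφe]
  -- Change of variables by the bijection `κ`: `A²` and `B²` now differ only by the Jacobian.
  have hB' : B ^ 2 = ∫⁻ q, ENNReal.ofReal |(1 - fderiv ℝ (grad G) q).det| * g (kap G q) := by
    have hinj : Set.InjOn (kap G) Set.univ := fun a _ b _ hab =>
      e.injective (by rw [he, he, hab])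
    have hsurj : kap G '' Set.univ = Set.univ := by
      rw [Set.image_univ, Set.range_eq_univ]
      intro p
      obtain ⟨q, rfl⟩ := e.surjective p
      exact ⟨q, (he q).symm⟩
    have := lintegral_image_eq_lintegral_abs_det_fderiv_mul (volume : Measure (PhaseSpace n))
      MeasurableSet.univ (fun x _ => (hasFDerivAt_kap hG x).hasFDerivWithinAt) hinj g
    rw [hsurj, setLIntegral_univ, setLIntegral_univ] at this
    rw [hB, ← this]
  have hfr : Module.finrank ℝ (PhaseSpace n) = n * 2 := by
    rw [Module.finrank_prod, finrank_euclideanSpace_fin]; ring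
  have hC2 : ENNReal.ofReal (2 ^ (n * 2)) = ((2 ^ n : ℝ≥0) : ℝ≥0∞) ^ 2 := by
    rw [ENNReal.ofReal_pow (by norm_num), pow_mul]
    simp
  have hD : ∀ q w, ‖fderiv ℝ (grad G) q w‖ ≤ 1 / 4 * ‖w‖ := fun q w =>
    (ContinuousLinearMap.le_opNorm _ _).trans (mul_le_mul_of_nonneg_right
      (norm_fderiv_grad_le (by norm_num) hL q) (norm_nonneg _))
  have hBA : B ^ 2 ≤ ((2 ^ n : ℝ≥0) : ℝ≥0∞) ^ 2 * A ^ 2 := by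
    rw [hB', hA', ← hC2, ← lintegral_const_mul' _ _ ENNReal.ofReal_ne_top]
    refine lintegral_mono fun q => mul_le_mul_left (ENNReal.ofReal_le_ofReal ?_) _
    rw [← hfr]
    refine abs_det_le_pow volume _ two_pos fun w => ?_
    have h1 : ‖(1 - fderiv ℝ (grad G) q) w‖ ≤ ‖w‖ + ‖fderiv ℝ (grad G) q w‖ := norm_sub_le w _
    linarith [hD q w, norm_nonneg w]
  have hAB : A ^ 2 ≤ ((2 ^ n : ℝ≥0) : ℝ≥0∞) ^ 2 * B ^ 2 := by
    rw [hB', hA', ← hC2, ← lintegral_const_mul' _ _ ENNReal.ofReal_ne_top]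
    refine lintegral_mono fun q => ?_
    rw [← mul_assoc, ← ENNReal.ofReal_mul (by positivity)]
    refine le_mul_of_one_le_left zero_le ?_
    rw [← ENNReal.ofReal_one]
    refine ENNReal.ofReal_le_ofReal ?_
    have := inv_pow_le_abs_det volume (1 - fderiv ℝ (grad G) q) two_pos fun w => by
      have h1 : ‖w‖ - ‖fderiv ℝ (grad G) q w‖ ≤ ‖(1 - fderiv ℝ (grad G) q) w‖ :=
        norm_sub_norm_le w _
      linarith [hD q w, norm_nonneg w]
    rw [hfr] at this
    exact (inv_le_iff_one_le_mul₀' (by positivity)).1 this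
  rw [← mul_pow] at hBA hAB
  have hBA' := (ENNReal.pow_le_pow_left_iff two_ne_zero).1 hBA
  have hAB' := (ENNReal.pow_le_pow_left_iff two_ne_zero).1 hAB
  have hBmem : MemLp (fbiReal h v) 2 (expMeasure h φ) := by
    obtain ⟨M, hM⟩ := hφ.continuous.bounded_above_of_compact_support hφc
    refine (memLp_fbiReal hh hv).of_measure_le_smul (c := ENNReal.ofReal (Real.exp (2 * M / h)))
      ENNReal.ofReal_ne_top ?_
    rw [expMeasure, ← withDensity_const]
    refine withDensity_mono (Filter.Eventually.of_forall fun p => ?_)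
    refine ENNReal.ofReal_le_ofReal (Real.exp_le_exp.2 (div_le_div_of_nonneg_right ?_ hh.le))
    have := (abs_le.1 (hM p)).1
    linarith
  refine ⟨⟨(stronglyMeasurable_fbi h hv.1 hZ hZeta).aestronglyMeasurable, ?_⟩, hBmem,
    ENNReal.div_le_of_le_mul' hAB', hBA'⟩
  -- Finiteness on `Λ` is inherited from the weighted real side.
  exact hAB'.trans_lt (ENNReal.mul_lt_top ENNReal.coe_lt_top hBmem.2)
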